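/- All graphs are finite and simple. A hole in a graph is a chordless cycle of length at least $4$; $\omega(G)$ denotes the maximum size of a clique of $G$, and $\mathrm{tw}(G)$ its treewidth, i.e. the minimum, over all tree decompositions of $G$, of the maximum of $|X|-1$ over the bags $X$. A class $\mathcal C$ of graphs is $(\mathrm{tw},\omega)$-bounded if it is hereditary (closed under taking induced subgraphs, up to isomorphism) and there is a function $b$ such that $\mathrm{tw}(G)\le b(\omega(G))$ for every $G\in\mathcal C$. **Theorem.** For every function $g:\mathbb N\setminus\{0\}\to\mathbb N\setminus\{0\}$ and every integer $\ell\ge 4$, there exists a $(\mathrm{tw},\omega)$-bounded class of graphs $\mathcal C$ such that every hole in every graph of $\mathcal C$ has length at least $\ell$ and, for every integer $k\ge 2$, there exists a graph $H\in\mathcal C$ with $\omega(H)=k$ and $\mathrm{tw}(H)\ge g(k)$. Consequently, it is not true that for every $(\mathrm{tw},\omega)$-bounded class $\mathcal C$ there is a polynomial $p$ such that $\mathrm{tw}(G)\le p(\omega(G))$ for every $G\in\mathcal C$ (a negative answer to a question of Dallard, Milanič and Štorgel). -/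

import Mathlib

universe u v

/-- A tree decomposition of `G` whose decomposition tree has node set `ι`. -/
structure TreeDecomposition {V : Type u} (G : SimpleGraph V) (ι : Type v) where
  /-- The decomposition tree. -/
  tree : SimpleGraph ι
  isTree : tree.IsTree
  /-- The bag assigned to each node. -/
  bag : ι → Set V
  exists_mem_bag : ∀ x : V, ∃ s, x ∈ bag s
  exists_bag_of_adj : ∀ x y : V, G.Adj x y → ∃ s, x ∈ bag s ∧ y ∈ bag s
  connected : ∀ x : V, (tree.induce {s | x ∈ bag s}).Connected

/-- The width of a tree decomposition of a finite graph: the maximum over all nodes of the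
size of the bag minus one. It is an integer; the value `-1` occurs only for the graph without
vertices. -/
noncomputable def TreeDecomposition.width {V : Type u} {G : SimpleGraph V} {ι : Type v}
    (D : TreeDecomposition G ι) : ℤ :=
  ⨆ s : ι, ((D.bag s).ncard : ℤ) - 1

/-- The treewidth of a finite graph: the minimum width of a tree decomposition
(over finite decomposition trees). -/
noncomputable def treewidth {V : Type u} [Finite V] (G : SimpleGraph V) : ℤ :=
  sInf {w : ℤ | ∃ (ι : Type) (_ : Finite ι) (D : TreeDecomposition G ι), D.width = w}

/-- A closed walk is a hole if it is a chordless cycle of length at least four. -/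
def IsHole {V : Type u} {G : SimpleGraph V} {x : V} (w : G.Walk x x) : Prop :=
  w.IsCycle ∧ w.IsChordless ∧ 4 ≤ w.length

/-- A class of finite simple graphs. -/
abbrev GraphClass : Type (u + 1) := (V : Type u) → [Finite V] → SimpleGraph V → Prop

/-- A class of finite graphs is hereditary if it is closed under induced subgraphs
(taken, as usual, up to isomorphism). -/
def GraphClass.Hereditary (C : GraphClass.{u}) : Prop :=
  ∀ (V W : Type u) [Finite V] [Finite W] (G : SimpleGraph V) (H : SimpleGraph W),
    C V G → Nonempty (H ↪g G) → C W H

/-- A class of finite graphs is `(tw, ω)`-bounded if it is hereditary and the treewidth of its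
members is bounded by a function of their clique number. -/
def GraphClass.TwOmegaBounded (C : GraphClass.{u}) : Prop :=
  C.Hereditary ∧
    ∃ b : ℕ → ℕ, ∀ (V : Type u) [Finite V] (G : SimpleGraph V),
      C V G → treewidth G ≤ (b G.cliqueNum : ℤ)

/-- The treewidth of the members of the class is bounded by a polynomial in their
clique number. -/
def GraphClass.PolynomiallyBounded (C : GraphClass.{u}) : Prop :=
  ∃ p : Polynomial ℝ, ∀ (V : Type u) [Finite V] (G : SimpleGraph V),
    C V G → (treewidth G : ℝ) ≤ p.eval (G.cliqueNum : ℝ)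

/-!
The class consists of the induced subgraphs of certain layered graphs, one for each `k ≥ 2`. Layers
`0, 1, …, m` are paths. Every vertex has a box of consecutive children in the next layer, and is
joined to some of its ancestors; these form a clique together with the vertex (`upClosed`). A
vertex is joined to at most `k - 1` ancestors, and one that is joined to any ancestor has a position
divisible by `l`. In a box, each way of choosing the neighbours above by discarding a single member
of the clique of the parent occurs.

*Clique number and treewidth.* A vertex of the lowest layer of a clique sees the rest of the clique
above it, so the clique number is `k`. Every ancestor can be kept as a neighbour along some branch,
so any two layers are joined by an edge, and contracting the layers gives a complete graph on
`m + 1` vertices. By the Helly property of subtrees (`SimpleGraph.IsTree.helly`), the treewidth is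
at least `m`, which may be chosen as large as desired, independently of `k`.

*Holes.* Consider the rightmost vertex of a hole in the lowest layer that the hole meets. It has a
neighbour above in the hole, as well as its neighbour to the left. From there the hole must follow
the layer to the left until the next position divisible by `l`. Hence its length is at least `l`
(`lt_card_of_exists_nonadj_neighbors`).

*Subgraphs with smaller clique number.* Let `X` be a set of vertices that induces a subgraph with
clique number `ω < k`. The clique of a vertex is never a clique of size `k` inside `X`, so some child
keeps all neighbours that belong to `X` (`exists_child`). Following such children downwards gives a
chain whose members in `X` all lie in the clique of its last vertex; so there are at most `ω` of
them, even together with the neighbours of the chain above its first vertex. As edges join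
consecutive vertices of a layer or a vertex to an ancestor, a chain separates what is to its left
from what is to its right. Cutting the graph along all chains gives a tree decomposition
(`ChildSystem.treeDecomposition`) in which every bag is covered by four such cliques, so the treewidth
is at most `4 * ω` (`treewidth_le_of_cliqueNum_lt`). This bound does not involve `k` or `m`.

A member of the class with clique number `ω` therefore has treewidth at most `4 * ω`, or it embeds in
one of the finitely many layered graphs with `k ≤ ω`. The negative answer for polynomials follows by
letting the treewidth exceed `3 ^ k`.
-/

/-! ### Cycles and holes -/

namespace SimpleGraph.Walk

variable {V : Type*} {G : SimpleGraph V}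

theorem IsCycle.exists_ne_adj_adj {x : V} {w : G.Walk x x} (hw : w.IsCycle) {y : V}
    (hy : y ∈ w.support) :
    ∃ a ∈ w.support, ∃ b ∈ w.support, a ≠ b ∧ G.Adj y a ∧ G.Adj y b := by
  classical
  have hc := hw.rotate hy
  have hmem : ∀ z, z ∈ (w.rotate y hy).support → z ∈ w.support := fun z hz ↦ by
    simpa using hz
  refine ⟨_, hmem _ (getVert_mem_support _ 1), _,
    hmem _ (getVert_mem_support _ ((w.rotate y hy).length - 1)), hc.snd_ne_penultimate,
    adj_snd hc.not_nil, (adj_penultimate hc.not_nil).symm⟩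

end SimpleGraph.Walk

/-- The two neighbours of a vertex along a hole are distinct and not adjacent. The bound on the
length of holes uses no other property of them. -/
theorem IsHole.exists_nonadj_neighbors {V : Type*} {G : SimpleGraph V} {x : V} {w : G.Walk x x}
    (hw : IsHole w) {y : V} (hy : y ∈ w.support) :
    ∃ a ∈ w.support, ∃ b ∈ w.support, a ≠ b ∧ G.Adj y a ∧ G.Adj y b ∧ ¬ G.Adj a b := by
  classical
  obtain ⟨hcyc, hch, hlen⟩ := hw
  have hc := hcyc.rotate hy
  have hmem : ∀ z, z ∈ (w.rotate y hy).support → z ∈ w.support := fun z hz ↦ by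
    simpa using hz
  have hlen' : 4 ≤ (w.rotate y hy).length := by simpa using hlen
  have ha := hmem _ (SimpleGraph.Walk.getVert_mem_support (w.rotate y hy) 1)
  have hb := hmem _ (SimpleGraph.Walk.getVert_mem_support (w.rotate y hy)
    ((w.rotate y hy).length - 1))
  refine ⟨_, ha, _, hb, hc.snd_ne_penultimate, SimpleGraph.Walk.adj_snd hc.not_nil,
    (SimpleGraph.Walk.adj_penultimate hc.not_nil).symm, fun hadj ↦ ?_⟩
  have he := hch.mem_edges ha hb hadj
  have he' := (SimpleGraph.Walk.rotate_edges w y hy).mem_iff.2 he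
  generalize w.rotate y hy = c at he' hlen' hc
  obtain ⟨i, hi, h⟩ := (SimpleGraph.Walk.mk_mem_edges_iff_exists c).1 he'
  -- Two vertices at positions `1` and `c.length - 1` of a cycle are consecutive only if the
  -- cycle is a triangle.
  have inj := hc.getVert_injOn
  have h0 : c.getVert 0 = c.getVert c.length := by simp
  rcases Sym2.eq_iff.1 h with ⟨h1, h2⟩ | ⟨h1, h2⟩
  · rcases Nat.eq_zero_or_pos i with rfl | hi0
    · have := inj ⟨by omega, le_rfl⟩ ⟨by omega, by omega⟩ (h0.symm.trans h1)
      omega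
    · have h3 := inj ⟨hi0, hi.le⟩ ⟨by omega, by omega⟩ h1
      have h4 := inj ⟨by omega, by omega⟩ ⟨by omega, by omega⟩ h2
      omega
  · have h3 := inj ⟨by omega, by omega⟩ ⟨by omega, by omega⟩ h2
    obtain rfl : i = 0 := by omega
    have := inj ⟨by omega, le_rfl⟩ ⟨by omega, by omega⟩ (h0.symm.trans h1)
    omega

/-! ### Trees given by parent pointers -/

/-- The graph joining every node other than `r` to its parent. -/
def parentGraph {ι : Type*} (r : ι) (p : ι → ι) : SimpleGraph ι :=
  SimpleGraph.fromRel fun s t ↦ s ≠ r ∧ p s = t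

section parentGraph

variable {ι : Type*} {r : ι} {p : ι → ι} {rank : ι → ℕ}

theorem parentGraph_adj_parent (hp : ∀ s, s ≠ r → rank (p s) < rank s) {s : ι} (hs : s ≠ r) :
    (parentGraph r p).Adj s (p s) := by
  rw [parentGraph, SimpleGraph.fromRel_adj]
  refine ⟨fun h ↦ ?_, Or.inl ⟨hs, rfl⟩⟩
  have := hp s hs
  rw [← h] at this
  exact this.false

theorem eq_parent_of_parentGraph_adj (hp : ∀ s, s ≠ r → rank (p s) < rank s) {s t : ι}
    (h : (parentGraph r p).Adj s t) (hr : rank t ≤ rank s) : p s = t := by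
  rw [parentGraph, SimpleGraph.fromRel_adj] at h
  rcases h.2 with h | ⟨h1, h2⟩
  · exact h.2
  · have := hp t h1
    rw [h2] at this
    omega

/-- A set of nodes is connected if only one of its members has its parent outside the set. -/
theorem parentGraph_induce_connected (hp : ∀ s, s ≠ r → rank (p s) < rank s) (T : Set ι)
    (hT : T.Nonempty)
    (huniq : ∀ s ∈ T, ∀ t ∈ T, (s ≠ r → p s ∉ T) → (t ≠ r → p t ∉ T) → s = t) :
    ((parentGraph r p).induce T).Connected := by
  classical
  obtain ⟨t₀, ht₀, hmin⟩ : ∃ t ∈ T, ∀ s ∈ T, rank t ≤ rank s := by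
    obtain ⟨t, ht⟩ := hT
    obtain ⟨n, hn, h⟩ : ∃ n, (∃ t ∈ T, rank t = n) ∧ ∀ j < n, ¬ ∃ t ∈ T, rank t = j :=
      have hex : ∃ n, ∃ t ∈ T, rank t = n := ⟨_, t, ht, rfl⟩
      ⟨Nat.find hex, Nat.find_spec hex, fun j hj ↦ Nat.find_min hex hj⟩
    obtain ⟨t, ht, rfl⟩ := hn
    exact ⟨t, ht, fun s hs ↦ not_lt.1 fun hlt ↦ h _ hlt ⟨s, hs, rfl⟩⟩
  have htop : t₀ ≠ r → p t₀ ∉ T := fun h h' ↦ absurd (hmin _ h') (not_le.2 (hp _ h))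
  rw [SimpleGraph.connected_iff_exists_forall_reachable]
  refine ⟨⟨t₀, ht₀⟩, ?_⟩
  have key : ∀ n, ∀ s (hs : s ∈ T), rank s = n →
      ((parentGraph r p).induce T).Reachable ⟨t₀, ht₀⟩ ⟨s, hs⟩ := by
    intro n
    induction n using Nat.strong_induction_on with
    | _ n ih =>
      intro s hs hn
      by_cases h : s ≠ r → p s ∉ T
      · obtain rfl := huniq s hs t₀ ht₀ h htop
        rfl
      · push Not at h
        obtain ⟨hsr, hps⟩ := h
        have h1 := ih _ (hn ▸ hp s hsr) (p s) hps rfl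
        refine h1.trans (SimpleGraph.Adj.reachable ?_)
        exact (parentGraph_adj_parent hp hsr).symm
  exact fun s ↦ key _ s.1 s.2 rfl

theorem parentGraph_isTree (hp : ∀ s, s ≠ r → rank (p s) < rank s) :
    (parentGraph r p).IsTree := by
  refine ⟨?_, fun x w hw ↦ ?_⟩
  · rw [← (SimpleGraph.induceUnivIso _).connected_iff]
    refine parentGraph_induce_connected hp _ ⟨r, trivial⟩ fun s _ t _ hs ht ↦ ?_
    have hs' : s = r := by_contra fun h ↦ hs h trivial
    have ht' : t = r := by_contra fun h ↦ ht h trivial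
    rw [hs', ht']
  · -- A vertex of maximal rank on a cycle would have two parents.
    classical
    obtain ⟨y, hy, hmax⟩ := w.support.toFinset.exists_max_image rank ⟨x, by simp⟩
    obtain ⟨a, ha, b, hb, hab, h1, h2⟩ := hw.exists_ne_adj_adj (List.mem_toFinset.1 hy)
    exact hab ((eq_parent_of_parentGraph_adj hp h1 (hmax a (by simpa using ha))).symm.trans
      (eq_parent_of_parentGraph_adj hp h2 (hmax b (by simpa using hb))))

end parentGraph

/-! ### The Helly property of subtrees -/

/-- In a tree, a walk visits every vertex of the path between its ends. -/
theorem SimpleGraph.IsAcyclic.support_subset {ι : Type*} {T : SimpleGraph ι} (hT : T.IsAcyclic)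
    {x y : ι} {p : T.Walk x y} (hp : p.IsPath) (q : T.Walk x y) : p.support ⊆ q.support := by
  classical
  have h : p = q.bypass :=
    congrArg Subtype.val ((hT.subsingleton_path x y).elim ⟨p, hp⟩ q.toPath)
  rw [h]
  exact q.support_bypass_subset_support

theorem SimpleGraph.exists_walk_of_induce_connected {ι : Type*} {T : SimpleGraph ι} {s : Set ι}
    (hs : (T.induce s).Connected) {x y : ι} (hx : x ∈ s) (hy : y ∈ s) :
    ∃ p : T.Walk x y, p.IsPath ∧ ∀ z ∈ p.support, z ∈ s := by
  obtain ⟨p, hp⟩ := hs.preconnected.exists_isPath ⟨x, hx⟩ ⟨y, hy⟩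
  refine ⟨p.map (SimpleGraph.Embedding.induce s).toHom, hp.map Subtype.val_injective,
    fun z hz ↦ ?_⟩
  obtain ⟨a, -, rfl⟩ := List.mem_map.1 ((SimpleGraph.Walk.support_map _ p) ▸ hz)
  exact a.2

theorem SimpleGraph.IsTree.helly {ι κ : Type*} [Finite κ] [Nonempty κ] {T : SimpleGraph ι}
    (hT : T.IsTree) (S : κ → Set ι) (hS : ∀ a, (T.induce (S a)).Connected)
    (hpair : ∀ a b, (S a ∩ S b).Nonempty) : ∃ t, ∀ a, t ∈ S a := by
  classical
  obtain ⟨r⟩ := hT.connected.nonempty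
  -- The vertex `t a` of `S a` closest to the root; the one farthest from the root is common.
  have htop : ∀ a, ∃ t ∈ S a, ∀ s ∈ S a, T.dist t r ≤ T.dist s r := fun a ↦ by
    have hex : ∃ n, ∃ t ∈ S a, T.dist t r = n :=
      let ⟨t, ht, _⟩ := hpair a a
      ⟨_, t, ht, rfl⟩
    obtain ⟨t, ht, h⟩ := Nat.find_spec hex
    exact ⟨t, ht, fun s hs ↦ h ▸ Nat.find_min' hex ⟨s, hs, rfl⟩⟩
  choose t ht hmin using htop
  obtain ⟨a, ha⟩ := Finite.exists_max fun a ↦ T.dist (t a) r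
  refine ⟨t a, fun b ↦ ?_⟩
  obtain ⟨y, hya, hyb⟩ := hpair a b
  have geod : ∀ x : ι, ∃ q : T.Walk x r, q.IsPath ∧
      ∀ z ∈ q.support, T.dist z r ≤ T.dist x r ∧ (z ≠ x → T.dist z r < T.dist x r) := by
    intro x
    obtain ⟨q, hq, hlen⟩ := hT.connected.exists_path_of_dist x r
    refine ⟨q, hq, fun z hz ↦ ?_⟩
    have h1 : T.dist z r ≤ (q.dropUntil z hz).length := SimpleGraph.dist_le _
    have h2 := congrArg SimpleGraph.Walk.length (q.take_spec hz)
    rw [SimpleGraph.Walk.length_append] at h2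
    refine ⟨by omega, fun hne ↦ ?_⟩
    have h3 : (q.takeUntil z hz).length ≠ 0 := fun h0 ↦
      hne (SimpleGraph.Walk.eq_of_length_eq_zero h0).symm
    omega
  obtain ⟨q, hq, hqd⟩ := geod (t a)
  obtain ⟨p, hp, hpS⟩ := SimpleGraph.exists_walk_of_induce_connected (hS a) hya (ht a)
  have hpath : (p.append q).IsPath := by
    rw [SimpleGraph.Walk.isPath_def, SimpleGraph.Walk.support_append, List.nodup_append]
    have hnd := hq.support_nodup
    rw [← SimpleGraph.Walk.cons_tail_support, List.nodup_cons] at hnd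
    refine ⟨hp.support_nodup, hnd.2, ?_⟩
    rintro z hz _ hzq rfl
    have hlt := (hqd z (List.mem_of_mem_tail hzq)).2 fun h ↦ hnd.1 (h ▸ hzq)
    exact absurd (hmin a z (hpS z hz)) (not_le.2 hlt)
  obtain ⟨p', -, hpS'⟩ := SimpleGraph.exists_walk_of_induce_connected (hS b) hyb (ht b)
  obtain ⟨q', -, hqd'⟩ := geod (t b)
  have hmem : t a ∈ (p'.append q').support :=
    hT.isAcyclic.support_subset hpath _ (by simp)
  rcases (SimpleGraph.Walk.mem_support_append_iff _ _).1 hmem with h | h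
  · exact hpS' _ h
  · by_cases hne : t a = t b
    · rw [hne]; exact ht b
    · exact absurd (ha b) (not_le.2 ((hqd' _ h).2 hne))

/-! ### Bounds on treewidth -/

namespace TreeDecomposition

variable {V : Type*} {G : SimpleGraph V} {ι : Type*}

theorem ncard_bag_sub_one_le_width [Finite ι] (D : TreeDecomposition G ι) (s : ι) :
    ((D.bag s).ncard : ℤ) - 1 ≤ D.width :=
  le_ciSup (f := fun s ↦ ((D.bag s).ncard : ℤ) - 1) (Set.finite_range _).bddAbove s

theorem width_le (D : TreeDecomposition G ι) {n : ℤ} (h : ∀ s, ((D.bag s).ncard : ℤ) - 1 ≤ n) :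
    D.width ≤ n :=
  haveI := D.isTree.connected.nonempty
  ciSup_le h

theorem neg_one_le_width [Finite ι] (D : TreeDecomposition G ι) : -1 ≤ D.width := by
  obtain ⟨s⟩ := D.isTree.connected.nonempty
  have := D.ncard_bag_sub_one_le_width s
  omega

/-- The tree decomposition with a single bag. -/
def trivial (G : SimpleGraph V) : TreeDecomposition G Unit where
  tree := ⊥
  isTree := .of_subsingleton
  bag _ := Set.univ
  exists_mem_bag _ := ⟨(), Set.mem_univ _⟩
  exists_bag_of_adj _ _ _ := ⟨(), Set.mem_univ _, Set.mem_univ _⟩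
  connected x := by
    have : Nonempty {_s : Unit | x ∈ (Set.univ : Set V)} := ⟨⟨(), Set.mem_univ x⟩⟩
    exact (SimpleGraph.IsTree.of_subsingleton).connected

/-- The nodes whose bags meet a connected set of vertices form a subtree. -/
theorem induce_meeting_connected (D : TreeDecomposition G ι)
    {L : Set V} (hL : (G.induce L).Connected) :
    (D.tree.induce {s | ∃ x ∈ L, x ∈ D.bag s}).Connected := by
  obtain ⟨x₀⟩ := hL.nonempty
  obtain ⟨s₀, hs₀⟩ := D.exists_mem_bag x₀
  have hsub : ∀ x ∈ L, {s | x ∈ D.bag s} ⊆ {s | ∃ x ∈ L, x ∈ D.bag s} := fun x hx s hs ↦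
    ⟨x, hx, hs⟩
  have key : ∀ {x y : L} (w : (G.induce L).Walk x y), ∀ s t (hs : x.1 ∈ D.bag s)
      (ht : y.1 ∈ D.bag t),
      (D.tree.induce {s | ∃ x ∈ L, x ∈ D.bag s}).Reachable ⟨s, x, x.2, hs⟩ ⟨t, y, y.2, ht⟩ := by
    intro x y w
    induction w with
    | @nil x =>
      intro s t hs ht
      exact ((D.connected x).preconnected ⟨s, hs⟩ ⟨t, ht⟩).map
        (SimpleGraph.induceHomOfLE _ (hsub x x.2)).toHom
    | @cons x z y h w ih =>
      intro s t hs ht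
      obtain ⟨s', hx', hz'⟩ := D.exists_bag_of_adj _ _ h
      refine SimpleGraph.Reachable.trans (v := ⟨s', x, x.2, hx'⟩) ?_ (ih s' t hz' ht)
      exact ((D.connected x).preconnected ⟨s, hs⟩ ⟨s', hx'⟩).map
        (SimpleGraph.induceHomOfLE _ (hsub x x.2)).toHom
  rw [SimpleGraph.connected_iff_exists_forall_reachable]
  refine ⟨⟨s₀, x₀, x₀.2, hs₀⟩, ?_⟩
  rintro ⟨t, y, hy, ht⟩
  obtain ⟨w⟩ := hL.preconnected x₀ ⟨y, hy⟩
  exact key w s₀ t hs₀ ht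

end TreeDecomposition

section treewidth

variable {V : Type*} [Finite V] {G : SimpleGraph V}

theorem treewidth_le {ι : Type} [Finite ι] (D : TreeDecomposition G ι) {n : ℤ}
    (h : ∀ s, ((D.bag s).ncard : ℤ) - 1 ≤ n) : treewidth G ≤ n := by
  have hbdd : BddBelow {w : ℤ | ∃ (ι : Type) (_ : Finite ι) (D : TreeDecomposition G ι),
      D.width = w} := by
    refine ⟨-1, ?_⟩
    rintro _ ⟨ι, _, D, rfl⟩
    exact D.neg_one_le_width
  exact (csInf_le hbdd ⟨ι, ‹_›, D, rfl⟩).trans (D.width_le h)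

theorem le_treewidth {n : ℤ}
    (h : ∀ (ι : Type) [Finite ι] (D : TreeDecomposition G ι), ∃ s, n ≤ ((D.bag s).ncard : ℤ) - 1) :
    n ≤ treewidth G := by
  refine le_csInf ⟨_, Unit, inferInstance, .trivial G, rfl⟩ ?_
  rintro _ ⟨ι, _, D, rfl⟩
  obtain ⟨s, hs⟩ := h ι D
  exact hs.trans (D.ncard_bag_sub_one_le_width s)

theorem treewidth_le_card (G : SimpleGraph V) : treewidth G ≤ Nat.card V := by
  refine treewidth_le (.trivial G) fun s ↦ ?_
  have : ((TreeDecomposition.trivial G).bag s).ncard = Nat.card V := Set.ncard_univ V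
  omega

/-- A clique minor with `m + 1` branch sets `layer ⁻¹' {i}` forces treewidth at least `m`. -/
theorem le_treewidth_of_minor {m : ℕ} (layer : V → ℕ)
    (hconn : ∀ i ≤ m, (G.induce {x | layer x = i}).Connected)
    (hadj : ∀ i j, i < j → j ≤ m → ∃ x y, layer x = i ∧ layer y = j ∧ G.Adj x y) :
    (m : ℤ) ≤ treewidth G := by
  refine le_treewidth fun ι _ D ↦ ?_
  obtain ⟨t, ht⟩ := D.isTree.helly
    (fun a : Fin (m + 1) ↦ {s | ∃ x ∈ {x | layer x = a.1}, x ∈ D.bag s})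
    (fun a ↦ D.induce_meeting_connected (hconn a (by omega))) (fun a b ↦ by
      rcases lt_trichotomy a.1 b.1 with h | h | h
      · obtain ⟨x, y, hx, hy, hxy⟩ := hadj a b h (by omega)
        obtain ⟨s, h1, h2⟩ := D.exists_bag_of_adj x y hxy
        exact ⟨s, ⟨x, hx, h1⟩, ⟨y, hy, h2⟩⟩
      · obtain ⟨x⟩ := (hconn a (by omega)).nonempty
        obtain ⟨s, hs⟩ := D.exists_mem_bag x
        exact ⟨s, ⟨x, x.2, hs⟩, ⟨x, x.2.trans h, hs⟩⟩
      · obtain ⟨x, y, hx, hy, hxy⟩ := hadj b a h (by omega)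
        obtain ⟨s, h1, h2⟩ := D.exists_bag_of_adj x y hxy
        exact ⟨s, ⟨y, hy, h2⟩, ⟨x, hx, h1⟩⟩)
  refine ⟨t, ?_⟩
  choose x hx hxt using ht
  have hinj : Function.Injective x := fun a b h ↦
    Fin.ext ((hx a).symm.trans ((congrArg layer h).trans (hx b)))
  have h1 : (Set.range x).ncard ≤ (D.bag t).ncard :=
    Set.ncard_le_ncard (by rintro _ ⟨a, rfl⟩; exact hxt a) (Set.toFinite _)
  have h2 : (Set.range x).ncard = m + 1 := by
    rw [← Set.image_univ, Set.ncard_image_of_injective _ hinj, Set.ncard_univ]; simp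
  omega

end treewidth

/-! ### The layered graph -/

/-- The number of vertices of layer `i + 1` below a vertex of layer `i`. -/
def boxSize (l m : ℕ) : ℕ := l * (m + 2)

/-- The set of neighbours, in the layers above layer `i`, of the `n`-th vertex of layer `i`.

The pair `(i, n)` stands for the `n`-th vertex of layer `i`; the parent of `(i + 1, n)` is
`(i, n / boxSize l m)`. A vertex whose position is not a multiple of `l` has no neighbour above.
The `r`-th vertex of a box, `r = l * s`, takes as neighbours the parent and the neighbours of the
parent, with the exception of the one in layer `s`, as long as these are fewer than `k`. -/
def upNbrs (l k m : ℕ) : ℕ → ℕ → Finset (ℕ × ℕ)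
  | 0, _ => ∅
  | i + 1, n =>
    let F := (insert (i, n / boxSize l m) (upNbrs l k m i (n / boxSize l m))).filter
      fun x ↦ x.1 ≠ n % boxSize l m / l
    if l ∣ n ∧ F.card < k then F else ∅

/-- A vertex together with its neighbours above. -/
def upClosed (l k m i n : ℕ) : Finset (ℕ × ℕ) := insert (i, n) (upNbrs l k m i n)

/-- The infinite layered graph: every layer is a one-way infinite path, and a vertex is joined to
the vertices of `upNbrs`. -/
def layeredGraph (l k m : ℕ) : SimpleGraph (ℕ × ℕ) :=
  SimpleGraph.fromRel fun x y ↦ y ∈ upNbrs l k m x.1 x.2 ∨ (x.1 = y.1 ∧ x.2 + 1 = y.2)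

section layeredGraph

variable {l k m : ℕ}

theorem upNbrs_succ_subset (i n : ℕ) :
    upNbrs l k m (i + 1) n ⊆ upClosed l k m i (n / boxSize l m) := by
  rw [upNbrs]
  split_ifs
  · exact Finset.filter_subset _ _
  · exact Finset.empty_subset _

theorem fst_lt_of_mem_upNbrs : ∀ {i n : ℕ} {x : ℕ × ℕ}, x ∈ upNbrs l k m i n → x.1 < i
  | 0, _, x, h => by simp [upNbrs] at h
  | i + 1, n, x, h => by
    rcases Finset.mem_insert.1 (upNbrs_succ_subset i n h) with rfl | h
    · exact Nat.lt_succ_self i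
    · exact (fst_lt_of_mem_upNbrs h).trans (Nat.lt_succ_self i)

theorem fst_le_of_mem_upClosed {i n : ℕ} {x : ℕ × ℕ} (h : x ∈ upClosed l k m i n) : x.1 ≤ i := by
  rcases Finset.mem_insert.1 h with rfl | h
  · exact le_rfl
  · exact (fst_lt_of_mem_upNbrs h).le

theorem dvd_of_upNbrs_nonempty {i n : ℕ} (h : (upNbrs l k m i n).Nonempty) : l ∣ n := by
  cases i with
  | zero => simp [upNbrs] at h
  | succ i =>
    rw [upNbrs] at h
    split_ifs at h with h'
    · exact h'.1
    · simp at h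

theorem card_upNbrs_lt (hk : 0 < k) (i n : ℕ) : (upNbrs l k m i n).card < k := by
  cases i with
  | zero => simpa [upNbrs] using hk
  | succ i =>
    rw [upNbrs]
    split_ifs with h'
    · exact h'.2
    · simpa using hk

theorem card_upClosed_le (hk : 0 < k) (i n : ℕ) : (upClosed l k m i n).card ≤ k :=
  (Finset.card_insert_le _ _).trans (card_upNbrs_lt hk i n)

theorem eq_of_fst_eq_of_mem_upClosed : ∀ {i n : ℕ} {x y : ℕ × ℕ}, x ∈ upClosed l k m i n →
    y ∈ upClosed l k m i n → x.1 = y.1 → x = y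
  | i, n, x, y, hx, hy, h => by
    rcases Finset.mem_insert.1 hx with rfl | hx <;> rcases Finset.mem_insert.1 hy with rfl | hy
    · rfl
    · have := fst_lt_of_mem_upNbrs hy
      simp at h; omega
    · have := fst_lt_of_mem_upNbrs hx
      simp at h; omega
    · cases i with
      | zero => simp [upNbrs] at hx
      | succ i =>
        exact eq_of_fst_eq_of_mem_upClosed (upNbrs_succ_subset i n hx)
          (upNbrs_succ_subset i n hy) h

theorem layeredGraph_adj {x y : ℕ × ℕ} : (layeredGraph l k m).Adj x y ↔
    y ∈ upNbrs l k m x.1 x.2 ∨ x ∈ upNbrs l k m y.1 y.2 ∨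
      (x.1 = y.1 ∧ (x.2 + 1 = y.2 ∨ y.2 + 1 = x.2)) := by
  rw [layeredGraph, SimpleGraph.fromRel_adj]
  constructor
  · rintro ⟨-, (h | h) | (h | h)⟩
    · exact Or.inl h
    · exact Or.inr (Or.inr ⟨h.1, Or.inl h.2⟩)
    · exact Or.inr (Or.inl h)
    · exact Or.inr (Or.inr ⟨h.1.symm, Or.inr h.2⟩)
  · rintro (h | h | ⟨h, h' | h'⟩)
    · exact ⟨fun e ↦ (e ▸ fst_lt_of_mem_upNbrs h).false, Or.inl (Or.inl h)⟩
    · exact ⟨fun e ↦ (e ▸ fst_lt_of_mem_upNbrs h).false, Or.inr (Or.inl h)⟩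
    · exact ⟨fun e ↦ by rw [e] at h'; omega, Or.inl (Or.inr ⟨h, h'⟩)⟩
    · exact ⟨fun e ↦ by rw [e] at h'; omega, Or.inr (Or.inr ⟨h.symm, h'⟩)⟩

/-- A neighbour in the same or a higher layer. -/
theorem layeredGraph_adj_of_le {x y : ℕ × ℕ} (h : (layeredGraph l k m).Adj x y)
    (hle : y.1 ≤ x.1) : y ∈ upNbrs l k m x.1 x.2 ∨
      (x.1 = y.1 ∧ (x.2 + 1 = y.2 ∨ y.2 + 1 = x.2)) := by
  rcases layeredGraph_adj.1 h with h | h | h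
  · exact Or.inl h
  · exact absurd (fst_lt_of_mem_upNbrs h) (not_lt.2 hle)
  · exact Or.inr h

theorem isClique_upClosed : ∀ i n : ℕ,
    (layeredGraph l k m).IsClique (upClosed l k m i n : Set (ℕ × ℕ))
  | 0, n => by simp [upClosed, upNbrs]
  | i + 1, n => by
    rw [upClosed, Finset.coe_insert, SimpleGraph.isClique_insert]
    refine ⟨(isClique_upClosed i (n / boxSize l m)).subset (upNbrs_succ_subset i n), ?_⟩
    exact fun x hx _ ↦ layeredGraph_adj.2 (Or.inl hx)

/-- Every vertex has a child that is joined to all members of `X` in the upward clique of the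
vertex, unless this clique has size `k` and lies in `X`. -/
theorem exists_child (hl : 0 < l) (hk : 0 < k) {i : ℕ} (hi : i ≤ m) (n : ℕ) (X : Set (ℕ × ℕ))
    (hX : ¬ ((upClosed l k m i n).card = k ∧ (upClosed l k m i n : Set (ℕ × ℕ)) ⊆ X)) :
    ∃ n', n' / boxSize l m = n ∧
      ∀ x ∈ upClosed l k m i n, x ∈ X → x ∈ upNbrs l k m (i + 1) n' := by
  have hchild : ∀ s ≤ m + 1, ((upClosed l k m i n).filter fun x ↦ x.1 ≠ s).card < k →
      ∃ n', n' / boxSize l m = n ∧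
        upNbrs l k m (i + 1) n' = (upClosed l k m i n).filter fun x ↦ x.1 ≠ s := by
    intro s hs hcard
    have hlt : l * s < boxSize l m := Nat.mul_lt_mul_of_pos_left (by omega) hl
    have hdiv : (boxSize l m * n + l * s) / boxSize l m = n := by
      rw [Nat.mul_add_div (by omega), Nat.div_eq_of_lt hlt, add_zero]
    have hmod : (boxSize l m * n + l * s) % boxSize l m / l = s := by
      rw [Nat.mul_add_mod, Nat.mod_eq_of_lt hlt, Nat.mul_div_cancel_left _ hl]
    refine ⟨boxSize l m * n + l * s, hdiv, ?_⟩
    rw [upNbrs]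
    rw [hdiv, hmod, if_pos]
    · rfl
    · refine ⟨?_, hcard⟩
      rw [boxSize, mul_assoc, ← mul_add]
      exact dvd_mul_right _ _
  by_cases hc : (upClosed l k m i n).card = k
  · obtain ⟨y, hy, hyX⟩ := Set.not_subset.1 fun h ↦ hX ⟨hc, h⟩
    have hy' := fst_le_of_mem_upClosed hy
    obtain ⟨n', h1, h2⟩ := hchild y.1 (by omega) ((Finset.card_lt_card
      (Finset.filter_ssubset.2 ⟨y, hy, not_not.2 rfl⟩)).trans_eq hc)
    refine ⟨n', h1, fun x hx hxX ↦ ?_⟩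
    rw [h2, Finset.mem_filter]
    exact ⟨hx, fun h ↦ hyX (eq_of_fst_eq_of_mem_upClosed hx hy h ▸ hxX)⟩
  · obtain ⟨n', h1, h2⟩ := hchild (m + 1) le_rfl
      ((Finset.card_filter_le _ _).trans_lt ((card_upClosed_le hk i n).lt_of_ne hc))
    refine ⟨n', h1, fun x hx _ ↦ ?_⟩
    rw [h2, Finset.mem_filter]
    have := fst_le_of_mem_upClosed hx
    exact ⟨hx, by omega⟩

/-! ### Cliques -/

theorem card_le_of_isClique (hl : 2 ≤ l) (hk : 2 ≤ k) {K : Finset (ℕ × ℕ)}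
    (hK : (layeredGraph l k m).IsClique (K : Set (ℕ × ℕ))) : K.card ≤ k := by
  rcases K.eq_empty_or_nonempty with rfl | hne
  · simp
  obtain ⟨v, hv, hmax⟩ := K.exists_max_image Prod.fst hne
  by_cases h : ∃ v' ∈ K, v' ≠ v ∧ v'.1 = v.1
  · -- The two consecutive vertices `v`, `v'` have no common neighbour.
    obtain ⟨v', hv', hne', heq⟩ := h
    suffices hsub : K ⊆ {v, v'} from (Finset.card_le_card hsub).trans (Finset.card_le_two.trans hk)
    intro y hy
    by_contra hy'
    simp only [Finset.mem_insert, Finset.mem_singleton, not_or] at hy'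
    have h1 := layeredGraph_adj_of_le (hK hv hy (Ne.symm hy'.1)) (hmax y hy)
    have h2 := layeredGraph_adj_of_le (hK hv' hy (Ne.symm hy'.2)) (heq ▸ hmax y hy)
    have h3 := layeredGraph_adj_of_le (hK hv hv' (Ne.symm hne')) heq.le
    have h3' : v.2 + 1 = v'.2 ∨ v'.2 + 1 = v.2 := by
      rcases h3 with h3 | h3
      · have := fst_lt_of_mem_upNbrs h3
        omega
      · exact h3.2
    rcases h1 with h1 | h1 <;> rcases h2 with h2 | h2
    · have d1 := dvd_of_upNbrs_nonempty ⟨_, h1⟩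
      have d2 := dvd_of_upNbrs_nonempty ⟨_, h2⟩
      have d3 : l ∣ 1 := by
        rcases h3' with h | h
        · rw [← h] at d2
          exact (Nat.dvd_add_right d1).1 d2
        · rw [← h] at d1
          exact (Nat.dvd_add_right d2).1 d1
      have := Nat.le_of_dvd one_pos d3
      omega
    · have := fst_lt_of_mem_upNbrs h1
      omega
    · have := fst_lt_of_mem_upNbrs h2
      omega
    · have h4 : y.2 ≠ v.2 := fun e ↦ hy'.1 (Prod.ext h1.1.symm e)
      have h5 : y.2 ≠ v'.2 := fun e ↦ hy'.2 (Prod.ext h2.1.symm e)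
      omega
  · push Not at h
    refine (Finset.card_le_card (t := upClosed l k m v.1 v.2) fun y hy ↦ ?_).trans
      (card_upClosed_le (by omega) _ _)
    by_cases hyv : y = v
    · exact hyv ▸ Finset.mem_insert_self _ _
    · rcases layeredGraph_adj_of_le (hK hv hy (Ne.symm hyv)) (hmax y hy) with h' | h'
      · exact Finset.mem_insert_of_mem h'
      · exact absurd h'.1.symm (h y hy hyv)

/-! ### Holes -/

/-- A finite set of vertices in which every vertex has two non-adjacent neighbours contains
`l + 1` consecutive vertices of its lowest layer. -/
theorem lt_card_of_exists_nonadj_neighbors {S : Finset (ℕ × ℕ)} (hne : S.Nonempty)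
    (hS : ∀ x ∈ S, ∃ a ∈ S, ∃ b ∈ S, a ≠ b ∧ (layeredGraph l k m).Adj x a ∧
      (layeredGraph l k m).Adj x b ∧ ¬ (layeredGraph l k m).Adj a b) : l < S.card := by
  obtain ⟨v, hv, hmax⟩ := S.exists_max_image Prod.fst hne
  obtain ⟨w, hw, hmax2⟩ := (S.filter fun x ↦ x.1 = v.1).exists_max_image Prod.snd
    ⟨v, by simpa using hv⟩
  obtain ⟨j, n⟩ := w
  rw [Finset.mem_filter] at hw
  obtain ⟨hw, hj⟩ := hw
  dsimp only at hj hmax2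
  have hup : ∀ p, ∀ a ∈ S, (layeredGraph l k m).Adj (j, p) a → a ∈ upNbrs l k m j p ∨
      (a.1 = j ∧ (p + 1 = a.2 ∨ a.2 + 1 = p)) := fun p a ha h ↦ by
    rcases layeredGraph_adj_of_le h (by simpa [hj] using hmax a ha) with h | h
    · exact Or.inl h
    · exact Or.inr ⟨h.1.symm, h.2⟩
  have hright : (j, n + 1) ∉ S := fun h ↦ by
    have := hmax2 _ (Finset.mem_filter.2 ⟨h, hj⟩)
    simp at this
  -- The rightmost vertex of the lowest layer has a neighbour above.
  have hdvd_left : l ∣ n ∧ 1 ≤ n ∧ (j, n - 1) ∈ S := by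
    have hcase : ∀ a ∈ S, (layeredGraph l k m).Adj (j, n) a →
        a ∈ upNbrs l k m j n ∨ 1 ≤ n ∧ a = (j, n - 1) := fun a ha h ↦ by
      rcases hup n a ha h with h | ⟨h1, h2 | h2⟩
      · exact Or.inl h
      · exact absurd (show (j, n + 1) ∈ S by rw [h2, ← h1]; exact ha) hright
      · exact Or.inr ⟨by omega, Prod.ext h1 (by dsimp only; omega)⟩
    obtain ⟨a, ha, b, hb, hab, h1, h2, h3⟩ := hS _ hw
    rcases hcase a ha h1 with h1 | h1 <;> rcases hcase b hb h2 with h2 | h2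
    · exact absurd (isClique_upClosed j n (Finset.mem_insert_of_mem h1)
        (Finset.mem_insert_of_mem h2) hab) h3
    · exact ⟨dvd_of_upNbrs_nonempty ⟨_, h1⟩, h2.1, h2.2 ▸ hb⟩
    · exact ⟨dvd_of_upNbrs_nonempty ⟨_, h2⟩, h1.1, h1.2 ▸ ha⟩
    · exact absurd (h1.2.trans h2.2.symm) hab
  obtain ⟨hdvd, hn1, hleft⟩ := hdvd_left
  -- The next vertices to the left have no neighbours above, so their neighbours lie in the layer.
  have hrun : ∀ t, 1 ≤ t → t ≤ l → t ≤ n ∧ (j, n - t) ∈ S := by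
    intro t ht
    induction t, ht using Nat.le_induction with
    | base => exact fun _ ↦ ⟨hn1, hleft⟩
    | succ t ht ih =>
      intro htl
      obtain ⟨htn, hmem⟩ := ih (by omega)
      have hnd : ¬ l ∣ n - t := fun h ↦ by
        have h' := (Nat.dvd_sub_iff_right htn hdvd).1 h
        have := Nat.le_of_dvd (by omega) h'
        omega
      have hcase : ∀ a ∈ S, (layeredGraph l k m).Adj (j, n - t) a →
          a = (j, n - t + 1) ∨ (t + 1 ≤ n ∧ a = (j, n - (t + 1))) := fun a ha h ↦ by
        rcases hup _ a ha h with h | ⟨h1, h2 | h2⟩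
        · exact absurd (dvd_of_upNbrs_nonempty ⟨_, h⟩) hnd
        · exact Or.inl (Prod.ext h1 h2.symm)
        · exact Or.inr ⟨by omega, Prod.ext h1 (by dsimp only; omega)⟩
      obtain ⟨a, ha, b, hb, hab, h1, h2, -⟩ := hS _ hmem
      rcases hcase a ha h1 with h1 | h1
      · rcases hcase b hb h2 with h2 | h2
        · exact absurd (h1.trans h2.symm) hab
        · exact ⟨h2.1, h2.2 ▸ hb⟩
      · exact ⟨h1.1, h1.2 ▸ ha⟩
  have hsub : (Finset.range (l + 1)).image (fun t ↦ (j, n - t)) ⊆ S := by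
    intro x hx
    obtain ⟨t, ht, rfl⟩ := Finset.mem_image.1 hx
    rw [Finset.mem_range] at ht
    rcases Nat.eq_zero_or_pos t with rfl | h
    · exact hw
    · exact (hrun t h (by omega)).2
  have hcard : ((Finset.range (l + 1)).image (fun t ↦ (j, n - t))).card = l + 1 := by
    rw [Finset.card_image_of_injOn, Finset.card_range]
    intro s hs t ht hst
    have hln : l ≤ n := by
      rcases Nat.eq_zero_or_pos l with h | h
      · omega
      · exact (hrun l h le_rfl).1
    simp only [Finset.coe_range, Set.mem_Iio] at hs ht
    have := congrArg Prod.snd hst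
    dsimp only at this
    omega
  have := Finset.card_le_card hsub
  omega

theorem le_length_of_isHole {V : Type*} {G : SimpleGraph V} (f : G ↪g layeredGraph l k m) {x : V}
    {w : G.Walk x x} (hw : IsHole w) : l ≤ w.length := by
  classical
  have h := lt_card_of_exists_nonadj_neighbors (l := l) (k := k) (m := m)
    (S := w.support.toFinset.image f) ⟨f x, by simp⟩ (by
      intro _ hfy
      obtain ⟨y, hy, rfl⟩ := Finset.mem_image.1 hfy
      obtain ⟨a, ha, b, hb, hab, h1, h2, h3⟩ := hw.exists_nonadj_neighbors (List.mem_toFinset.1 hy)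
      exact ⟨f a, Finset.mem_image_of_mem _ (List.mem_toFinset.2 ha), f b,
        Finset.mem_image_of_mem _ (List.mem_toFinset.2 hb), f.injective.ne hab,
        f.map_adj_iff.2 h1, f.map_adj_iff.2 h2, fun h ↦ h3 (f.map_adj_iff.1 h)⟩)
  have h1 := Finset.card_image_le (s := w.support.toFinset) (f := f)
  have h2 := w.support.toFinset_card_le
  rw [SimpleGraph.Walk.length_support] at h2
  omega

end layeredGraph

/-! ### The finite members of the class -/

/-- The vertex set of the finite layered graphs. The column `0` is left out: in the infinite
graph, it bounds this region from the left. -/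
def layerRegion (l m : ℕ) : Set (ℕ × ℕ) :=
  {x | x.1 ≤ m ∧ 0 < x.2 ∧ x.2 < boxSize l m ^ (x.1 + 1)}

theorem finite_setOf_le_lt_boxSize_pow {l m : ℕ} (hl : 0 < l) :
    {x : ℕ × ℕ | x.1 ≤ m ∧ x.2 < boxSize l m ^ (x.1 + 1)}.Finite := by
  refine ((Set.finite_Iic m).prod (Set.finite_Iio (boxSize l m ^ (m + 1)))).subset ?_
  intro x hx
  refine ⟨hx.1, hx.2.trans_le (Nat.pow_le_pow_right (Nat.mul_pos hl (by omega)) ?_)⟩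
  exact Nat.succ_le_succ hx.1

theorem finite_layerRegion {l m : ℕ} (hl : 0 < l) : (layerRegion l m).Finite :=
  (finite_setOf_le_lt_boxSize_pow hl).subset fun _ hx ↦ ⟨hx.1, hx.2.2⟩

/-- The finite layered graph, with layers `0, …, m`, on a vertex set in an arbitrary universe. -/
abbrev finiteLayeredGraph (l k m : ℕ) : SimpleGraph (ULift.{u} (layerRegion l m)) :=
  (layeredGraph l k m).comap fun x ↦ x.down.1

/-- The finite layered graph is an induced subgraph of the infinite one. -/
def finiteLayeredGraphEmbedding (l k m : ℕ) :
    finiteLayeredGraph.{u} l k m ↪g layeredGraph l k m :=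
  ⟨⟨fun x ↦ x.down.1, Subtype.val_injective.comp ULift.down_injective⟩, Iff.rfl⟩

section finiteLayeredGraph

variable {l k m : ℕ}

theorem one_lt_boxSize (hl : 0 < l) : 1 < boxSize l m := by
  have := Nat.mul_le_mul (show 1 ≤ l from hl) (show 2 ≤ m + 2 by omega)
  rw [boxSize]
  omega

theorem layerRegion_child (hl : 0 < l) {i n n' : ℕ} (h : (i, n) ∈ layerRegion l m)
    (hi : i + 1 ≤ m) (hn : n' / boxSize l m = n) : (i + 1, n') ∈ layerRegion l m := by
  obtain ⟨-, h2, h3⟩ := h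
  dsimp only at h2 h3
  have hN := one_lt_boxSize (m := m) hl
  refine ⟨hi, Nat.pos_of_ne_zero fun h ↦ ?_, ?_⟩
  · dsimp only at h
    rw [h, Nat.zero_div] at hn
    omega
  · dsimp only
    rw [pow_succ, ← Nat.div_lt_iff_lt_mul (by omega), hn]
    exact h3

theorem cliqueNum_le_of_embedding {V : Type*} [Finite V] {G : SimpleGraph V} (hl : 2 ≤ l)
    (hk : 2 ≤ k) (f : G ↪g layeredGraph l k m) : G.cliqueNum ≤ k := by
  obtain ⟨s, hs⟩ := G.exists_isNClique_cliqueNum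
  rw [← hs.card_eq, ← Finset.card_map f.toEmbedding]
  refine card_le_of_isClique (l := l) (m := m) hl hk ?_
  rw [Finset.coe_map]
  rintro _ ⟨x, hx, rfl⟩ _ ⟨y, hy, rfl⟩ hne
  exact f.map_adj_iff.2 (hs.isClique hx hy fun h ↦ hne (h ▸ rfl))

theorem card_le_cliqueNum_of_embedding {V : Type*} [Finite V] {G : SimpleGraph V}
    (f : G ↪g layeredGraph l k m) {K : Finset (ℕ × ℕ)}
    (hK : (layeredGraph l k m).IsClique (K : Set (ℕ × ℕ))) (hKf : (K : Set _) ⊆ Set.range f) :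
    K.card ≤ G.cliqueNum := by
  classical
  have himg : (K.preimage f f.injective.injOn).image f = K := by
    rw [Finset.image_preimage, Finset.filter_true_of_mem]
    exact fun x hx ↦ hKf hx
  rw [← himg, Finset.card_image_of_injective _ f.injective]
  refine SimpleGraph.IsClique.card_le_cliqueNum (tc := ?_)
  intro x hx y hy hne
  rw [Finset.coe_preimage] at hx hy
  exact f.map_adj_iff.1 (hK hx hy (f.injective.ne hne))

/-- Keeping all neighbours in each of the first `k` layers produces a clique of size `k`. -/
theorem exists_upClosed_card_eq (hl : 0 < l) : ∀ i < k, i ≤ m → ∃ n, (i, n) ∈ layerRegion l m ∧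
    (upClosed l k m i n).card = i + 1 ∧ (upClosed l k m i n : Set (ℕ × ℕ)) ⊆ layerRegion l m
  | 0, _, _ => by
    have h : (0, 1) ∈ layerRegion l m :=
      ⟨Nat.zero_le _, one_pos, by simpa using one_lt_boxSize hl⟩
    refine ⟨1, h, by simp [upClosed, upNbrs], ?_⟩
    simpa [upClosed, upNbrs] using h
  | i + 1, hik, him => by
    obtain ⟨n, h1, h2, h3⟩ := exists_upClosed_card_eq hl i (by omega) (by omega)
    obtain ⟨n', h4, h5⟩ := exists_child (k := k) (m := m) hl (by omega) (show i ≤ m by omega) n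
      Set.univ (by omega)
    have heq : upNbrs l k m (i + 1) n' = upClosed l k m i n :=
      Finset.Subset.antisymm (h4 ▸ upNbrs_succ_subset i n') fun x hx ↦ h5 x hx trivial
    have h6 := layerRegion_child hl h1 him h4
    refine ⟨n', h6, ?_, ?_⟩
    · rw [upClosed, Finset.card_insert_of_notMem, heq, h2]
      exact fun h ↦ (fst_lt_of_mem_upNbrs h).false
    · rw [upClosed, Finset.coe_insert, heq]
      exact Set.insert_subset h6 h3

theorem cliqueNum_finiteLayeredGraph (hl : 2 ≤ l) (hk : 2 ≤ k) (hkm : k ≤ m) :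
    (finiteLayeredGraph.{u} l k m).cliqueNum = k := by
  have : Finite (layerRegion l m) := finite_layerRegion (by omega)
  refine le_antisymm (cliqueNum_le_of_embedding hl hk (finiteLayeredGraphEmbedding.{u} l k m)) ?_
  obtain ⟨n, -, h2, h3⟩ := exists_upClosed_card_eq (l := l) (k := k) (m := m) (by omega) (k - 1)
    (by omega) (by omega)
  have := card_le_cliqueNum_of_embedding (G := finiteLayeredGraph.{u} l k m)
    (finiteLayeredGraphEmbedding.{u} l k m) (isClique_upClosed (k - 1) n)
    (fun x hx ↦ ⟨⟨⟨x, h3 hx⟩⟩, rfl⟩)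
  omega

theorem exists_mem_upClosed (hl : 0 < l) (hk : 2 ≤ k) {i j : ℕ} (hij : i ≤ j) (hj : j ≤ m) :
    ∃ n, (j, n) ∈ layerRegion l m ∧ (i, 1) ∈ upClosed l k m j n := by
  induction j, hij using Nat.le_induction with
  | base =>
    exact ⟨1, ⟨hj, one_pos, Nat.one_lt_pow (by omega) (one_lt_boxSize hl)⟩,
      Finset.mem_insert_self _ _⟩
  | succ j hij ih =>
    obtain ⟨n, h1, h2⟩ := ih (by omega)
    obtain ⟨n', h4, h5⟩ := exists_child (k := k) (m := m) hl (by omega) (show j ≤ m by omega) n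
      {(i, 1)} (fun h ↦ by
        have := Finset.card_le_card (show upClosed l k m j n ⊆ {(i, 1)} by
          intro x hx
          simpa using h.2 hx)
        rw [h.1, Finset.card_singleton] at this
        omega)
    exact ⟨n', layerRegion_child hl h1 hj h4, Finset.mem_insert_of_mem (h5 _ h2 rfl)⟩

/-- Contracting each layer to a vertex yields a complete graph. -/
theorem le_treewidth_finiteLayeredGraph [Finite (layerRegion l m)] (hl : 0 < l) (hk : 2 ≤ k) :
    (m : ℤ) ≤ treewidth (finiteLayeredGraph.{u} l k m) := by
  have hmem : ∀ i ≤ m, (i, 1) ∈ layerRegion l m := fun i hi ↦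
    ⟨hi, one_pos, Nat.one_lt_pow (by omega) (one_lt_boxSize hl)⟩
  refine le_treewidth_of_minor (fun x ↦ x.down.1.1) (fun i hi ↦ ?_) (fun i j hij hj ↦ ?_)
  · rw [SimpleGraph.connected_iff_exists_forall_reachable]
    refine ⟨⟨⟨⟨(i, 1), hmem i hi⟩⟩, rfl⟩, ?_⟩
    rintro ⟨⟨⟨⟨i', n⟩, hn⟩⟩, hi'⟩
    obtain rfl : i' = i := hi'
    have h1 : 1 ≤ n := hn.2.1
    induction n, h1 using Nat.le_induction with
    | base => rfl
    | succ n h1 ih =>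
      have hn' : (i', n) ∈ layerRegion l m :=
        ⟨hi, h1, lt_trans (Nat.lt_succ_self n) hn.2.2⟩
      refine (ih hn').trans (SimpleGraph.Adj.reachable ?_)
      exact layeredGraph_adj.2 (Or.inr (Or.inr ⟨rfl, Or.inl rfl⟩))
  · obtain ⟨n, h1, h2⟩ := exists_mem_upClosed (l := l) (k := k) (m := m) hl hk hij.le hj
    refine ⟨⟨⟨(i, 1), hmem i (by omega)⟩⟩, ⟨⟨(j, n), h1⟩⟩, rfl, rfl, ?_⟩
    rcases Finset.mem_insert.1 h2 with h | h
    · have := congrArg Prod.fst h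
      dsimp only at this
      omega
    · exact layeredGraph_adj.2 (Or.inr (Or.inl h))

end finiteLayeredGraph

/-! ### Induced subgraphs without large cliques -/

/-- A choice of one child for every vertex, such that all neighbours above the child that could
belong to `X` do belong to its neighbourhood. Following the chosen children downwards gives, for
every vertex, a chain that separates the layers below into a left and a right part. -/
structure ChildSystem (l k m : ℕ) (X : Set (ℕ × ℕ)) where
  /-- The position in layer `i + 1` of the chosen child of `(i, u)`. -/
  child : ℕ → ℕ → ℕ
  child_div : ∀ i < m, ∀ u, child i u / boxSize l m = u
  child_zero : ∀ i, child i 0 = 0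
  mem_upNbrs_child : ∀ i < m, ∀ u, ∀ x ∈ upClosed l k m i u, x ∈ X →
    x ∈ upNbrs l k m (i + 1) (child i u)
  snd_ne_zero : ∀ x ∈ X, x.2 ≠ 0

theorem snd_eq_zero_of_mem_upClosed {l k m : ℕ} :
    ∀ {i : ℕ} {x : ℕ × ℕ}, x ∈ upClosed l k m i 0 → x.2 = 0
  | 0, x, h => by
    rw [upClosed, upNbrs, Finset.mem_insert] at h
    simp at h
    rw [h]
  | i + 1, x, h => by
    rcases Finset.mem_insert.1 h with rfl | h
    · rfl
    · have := upNbrs_succ_subset i 0 h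
      rw [Nat.zero_div] at this
      exact snd_eq_zero_of_mem_upClosed this

namespace ChildSystem

variable {l k m : ℕ} {X : Set (ℕ × ℕ)} (C : ChildSystem l k m X)

/-- The position reached from `(i, q)` by moving down `d` times to the chosen child. -/
def descend : ℕ → ℕ → ℕ → ℕ
  | 0, _, q => q
  | d + 1, i, q => descend d (i + 1) (C.child i q)

/-- The members of `X` on the chain starting at `(i, q)`, together with the neighbours above
`(i, q)`. They all belong to the upward clique of the end of the chain. -/
def sep (i q : ℕ) : Set (ℕ × ℕ) := X ∩ upClosed l k m m (C.descend (m - i) i q)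

/-- The first vertex of the chain through a given vertex. -/
def top : ℕ → ℕ → ℕ × ℕ
  | 0, n => (0, n)
  | i + 1, n => if n = C.child i (n / boxSize l m) then top i (n / boxSize l m) else (i + 1, n)

/-- The gap to the right of `(i + 1, q)` lies between the chains starting at the vertices
`upper i q` and `upper i q + 1` of layer `i`. -/
def upper (i q : ℕ) : ℕ :=
  if C.child i (q / boxSize l m) ≤ q then q / boxSize l m else q / boxSize l m - 1

/-- The bag of the node `(i, q)`, which represents the gap between the vertices `q` and `q + 1`
of layer `i`. -/
def gapBag : ℕ × ℕ → Set (ℕ × ℕ)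
  | (0, q) => C.sep 0 q ∪ C.sep 0 (q + 1)
  | (i + 1, q) => C.sep (i + 1) q ∪ C.sep (i + 1) (q + 1) ∪
      (C.sep i (C.upper i q) ∪ C.sep i (C.upper i q + 1))

/-- The parent of a gap is the gap to its left, unless a chain coming from the layer above lies in
between; in that case it is the gap to the right of that chain in the layer above. -/
def gapParent : ℕ × ℕ → ℕ × ℕ
  | (0, q) => (0, q - 1)
  | (i + 1, q) => if q = C.child i (q / boxSize l m) then (i, q / boxSize l m) else (i + 1, q - 1)

theorem sep_child {i : ℕ} (hi : i < m) (q : ℕ) : C.sep (i + 1) (C.child i q) = C.sep i q := by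
  rw [sep, sep, show m - i = m - (i + 1) + 1 by omega, descend]

theorem mem_sep_of_mem_upClosed {x : ℕ × ℕ} (hx : x ∈ X) {i q : ℕ} (hi : i ≤ m)
    (h : x ∈ upClosed l k m i q) : x ∈ C.sep i q := by
  induction hi using Nat.decreasingInduction generalizing q with
  | self => exact ⟨hx, by rwa [Nat.sub_self]⟩
  | of_succ i hi ih =>
    rw [← C.sep_child hi]
    exact ih (Finset.mem_insert_of_mem (C.mem_upNbrs_child i hi q x h hx))

theorem mem_upNbrs_or_top_eq_of_mem_sep {x : ℕ × ℕ} {i q : ℕ} (hi : i ≤ m)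
    (h : x ∈ C.sep i q) : x ∈ upNbrs l k m i q ∨ C.top x.1 x.2 = C.top i q := by
  induction hi using Nat.decreasingInduction generalizing q with
  | self =>
    have h' := h.2
    rw [Nat.sub_self] at h'
    rcases Finset.mem_insert.1 h' with rfl | h'
    · exact Or.inr rfl
    · exact Or.inl h'
  | of_succ i hi ih =>
    rw [← C.sep_child hi] at h
    rcases ih h with h | h
    · have h' := upNbrs_succ_subset _ _ h
      rw [C.child_div i hi] at h'
      rcases Finset.mem_insert.1 h' with rfl | h'
      · exact Or.inr rfl
      · exact Or.inl h'
    · rw [h, top, C.child_div i hi, if_pos rfl]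
      exact Or.inr rfl

theorem sep_zero {i : ℕ} : C.sep i 0 = ∅ := by
  have h : ∀ d i, C.descend d i 0 = 0 := by
    intro d
    induction d with
    | zero => exact fun _ ↦ rfl
    | succ d ih => exact fun i ↦ by rw [descend, C.child_zero, ih]
  rw [sep, h, Set.eq_empty_iff_forall_notMem]
  exact fun x hx ↦ C.snd_ne_zero x hx.1 (snd_eq_zero_of_mem_upClosed hx.2)

theorem sep_subset_gapBag (i q : ℕ) : C.sep i q ⊆ C.gapBag (i, q) := by
  cases i with
  | zero => exact Set.subset_union_left
  | succ i => exact Set.subset_union_left.trans Set.subset_union_left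

theorem sep_succ_subset_gapBag (i q : ℕ) : C.sep i (q + 1) ⊆ C.gapBag (i, q) := by
  cases i with
  | zero => exact Set.subset_union_right
  | succ i => exact Set.subset_union_right.trans Set.subset_union_left

theorem succ_div_eq_upper (i q : ℕ) (hi : i < m) :
    (q + 1) / boxSize l m = C.upper i q ∨ (q + 1) / boxSize l m = C.upper i q + 1 := by
  have h1 : q / boxSize l m ≤ (q + 1) / boxSize l m := Nat.div_le_div_right (Nat.le_succ q)
  have h2 : (q + 1) / boxSize l m ≤ q / boxSize l m + 1 := by
    rw [Nat.succ_div]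
    split_ifs <;> omega
  rw [upper]
  split_ifs with h
  · omega
  · have h3 : (q + 1) / boxSize l m ≤ C.child i (q / boxSize l m) / boxSize l m :=
      Nat.div_le_div_right (by omega)
    rw [C.child_div i hi] at h3
    have h4 : q / boxSize l m ≠ 0 := fun h0 ↦ by
      rw [h0, C.child_zero] at h
      omega
    generalize q / boxSize l m = a at h1 h2 h3 h4 ⊢
    omega

theorem upper_pred {i q : ℕ} (hi : i < m) (hq : q ≠ C.child i (q / boxSize l m)) :
    C.upper i (q - 1) = C.upper i q := by
  have h1 : (q - 1) / boxSize l m ≤ q / boxSize l m := Nat.div_le_div_right (Nat.sub_le _ _)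
  have h2 : q / boxSize l m ≤ (q - 1) / boxSize l m + 1 := by
    cases q with
    | zero => simp
    | succ q =>
      rw [Nat.succ_div, Nat.add_sub_cancel]
      split_ifs <;> omega
  rcases h1.eq_or_lt with h | h
  · rw [upper, upper, h]
    congr 1
    exact propext ⟨fun h ↦ by omega, fun h ↦ by omega⟩
  · have h3 : ¬ C.child i (q / boxSize l m) ≤ q := fun hle ↦ by
      have := Nat.div_le_div_right (c := boxSize l m)
        (show C.child i (q / boxSize l m) ≤ q - 1 by omega)
      rw [C.child_div i hi] at this
      omega
    have h4 : C.child i ((q - 1) / boxSize l m) ≤ q - 1 := by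
      by_contra hle
      have := Nat.div_le_div_right (c := boxSize l m)
        (show q ≤ C.child i ((q - 1) / boxSize l m) by omega)
      rw [C.child_div i hi] at this
      omega
    rw [upper, upper, if_pos h4, if_neg h3]
    generalize q / boxSize l m = a at h h2 ⊢
    generalize (q - 1) / boxSize l m = b at h h2 ⊢
    omega

/-- A vertex of the separator to the right of a gap is visible from the layer above, unless it
lies on a chain that starts there. -/
theorem mem_sep_upper_or_top_eq {x : ℕ × ℕ} {i q : ℕ} (hi : i < m)
    (h : x ∈ C.sep (i + 1) (q + 1)) :
    x ∈ C.sep i (C.upper i q) ∪ C.sep i (C.upper i q + 1) ∨ C.top x.1 x.2 = (i + 1, q + 1) := by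
  have key : x ∈ C.sep i ((q + 1) / boxSize l m) →
      x ∈ C.sep i (C.upper i q) ∪ C.sep i (C.upper i q + 1) := fun hx ↦ by
    rcases C.succ_div_eq_upper i q hi with e | e
    · exact Or.inl (e ▸ hx)
    · exact Or.inr (e ▸ hx)
  by_cases hc : q + 1 = C.child i ((q + 1) / boxSize l m)
  · rw [hc, C.sep_child hi] at h
    exact Or.inl (key h)
  · rcases C.mem_upNbrs_or_top_eq_of_mem_sep (Nat.succ_le_of_lt hi) h with h' | h'
    · exact Or.inl (key (C.mem_sep_of_mem_upClosed h.1 hi.le (upNbrs_succ_subset _ _ h')))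
    · rw [h', top, if_neg hc]
      exact Or.inr rfl

/-- The bags containing `x` form a subtree, rooted at the gap to the left of the chain
through `x`. -/
theorem mem_gapBag_gapParent_or_top_eq {x t : ℕ × ℕ} (ht : t.1 ≤ m) (h : x ∈ C.gapBag t) :
    (t ≠ (0, 0) ∧ x ∈ C.gapBag (C.gapParent t)) ∨ C.top x.1 x.2 = (t.1, t.2 + 1) := by
  obtain ⟨i, q⟩ := t
  cases i with
  | zero =>
    rcases h with h | h
    · have hq : q ≠ 0 := by
        rintro rfl
        rw [C.sep_zero] at h
        exact h
      obtain ⟨q, rfl⟩ := Nat.exists_eq_succ_of_ne_zero hq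
      exact Or.inl ⟨by simp, C.sep_succ_subset_gapBag 0 q h⟩
    · rcases C.mem_upNbrs_or_top_eq_of_mem_sep ht h with h | h
      · simp [upNbrs] at h
      · exact Or.inr h
  | succ i =>
    have hi : i < m := ht
    have hne : (i + 1, q) ≠ (0, 0) := by simp
    suffices hsuff : x ∈ C.sep (i + 1) q ∪ (C.sep i (C.upper i q) ∪ C.sep i (C.upper i q + 1)) →
        x ∈ C.gapBag (C.gapParent (i + 1, q)) by
      rcases h with (h | h) | h
      · exact Or.inl ⟨hne, hsuff (Or.inl h)⟩
      · rcases C.mem_sep_upper_or_top_eq hi h with h | h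
        · exact Or.inl ⟨hne, hsuff (Or.inr h)⟩
        · exact Or.inr h
      · exact Or.inl ⟨hne, hsuff (Or.inr h)⟩
    rw [gapParent]
    split_ifs with hc
    · have hup : C.upper i q = q / boxSize l m := by rw [upper, if_pos hc.symm.le]
      have hs : C.sep (i + 1) q = C.sep i (q / boxSize l m) := by
        conv_lhs => rw [hc]
        exact C.sep_child hi _
      rw [hup, hs]
      rintro (h | h | h)
      · exact C.sep_subset_gapBag _ _ h
      · exact C.sep_subset_gapBag _ _ h
      · exact C.sep_succ_subset_gapBag _ _ h
    · have hq : q ≠ 0 := by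
        rintro rfl
        rw [Nat.zero_div, C.child_zero] at hc
        exact hc rfl
      rw [← C.upper_pred hi hc]
      rintro (h | h)
      · refine C.sep_succ_subset_gapBag _ _ ?_
        rwa [Nat.sub_add_cancel (by omega)]
      · exact Or.inr h

/-- The set of gaps that serve as nodes of the decomposition tree. -/
abbrev Gap (l m : ℕ) : Type := {x : ℕ × ℕ | x.1 ≤ m ∧ x.2 < boxSize l m ^ (x.1 + 1)}

theorem gapParent_mem (hl : 0 < l) {t : ℕ × ℕ} (ht : t.1 ≤ m ∧ t.2 < boxSize l m ^ (t.1 + 1)) :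
    (C.gapParent t).1 ≤ m ∧ (C.gapParent t).2 < boxSize l m ^ ((C.gapParent t).1 + 1) := by
  obtain ⟨i, q⟩ := t
  obtain ⟨h1, h2⟩ := ht
  dsimp only at h1 h2
  cases i with
  | zero => exact ⟨h1, lt_of_le_of_lt (Nat.sub_le _ _) h2⟩
  | succ i =>
    rw [gapParent]
    split_ifs
    · refine ⟨by dsimp only; omega, ?_⟩
      dsimp only
      rw [Nat.div_lt_iff_lt_mul (show 0 < boxSize l m from Nat.mul_pos hl (by omega)), ← pow_succ]
      exact h2
    · exact ⟨h1, lt_of_le_of_lt (Nat.sub_le _ _) h2⟩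

theorem gapParent_sum_lt {t : ℕ × ℕ} (ht : t ≠ (0, 0)) :
    (C.gapParent t).1 + (C.gapParent t).2 < t.1 + t.2 := by
  obtain ⟨i, q⟩ := t
  cases i with
  | zero =>
    have : q ≠ 0 := fun h ↦ ht (h ▸ rfl)
    simp only [gapParent]
    omega
  | succ i =>
    rw [gapParent]
    split_ifs with hc
    · have := Nat.div_le_self q (boxSize l m)
      dsimp only
      omega
    · have hq : q ≠ 0 := by
        rintro rfl
        rw [Nat.zero_div, C.child_zero] at hc
        exact hc rfl
      dsimp only
      omega

/-- The tree decomposition of an induced subgraph of the layered graph whose nodes are the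
gaps. -/
def treeDecomposition (hl : 0 < l) {V : Type u} {G : SimpleGraph V} (f : G ↪g layeredGraph l k m)
    (hf : ∀ v, f v ∈ layerRegion l m) (C : ChildSystem l k m (Set.range f)) :
    TreeDecomposition G (Gap l m) :=
  have hp : ∀ t : Gap l m, t ≠ ⟨(0, 0), Nat.zero_le _, pow_pos (Nat.mul_pos hl (by omega)) _⟩ →
      (C.gapParent t).1 + (C.gapParent t).2 < t.1.1 + t.1.2 := fun t ht ↦
    C.gapParent_sum_lt fun h ↦ ht (Subtype.ext h)
  have hsep : ∀ (v : V) (i q : ℕ), i ≤ m → f v ∈ upClosed l k m i q → f v ∈ C.sep i q :=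
    fun v _ _ hi h ↦ C.mem_sep_of_mem_upClosed ⟨v, rfl⟩ hi h
  have hself : ∀ v, f v ∈ C.sep (f v).1 (f v).2 := fun v ↦
    hsep v _ _ (hf v).1 (Finset.mem_insert_self _ _)
  have hgap : ∀ v, f v ∈ {x : ℕ × ℕ | x.1 ≤ m ∧ x.2 < boxSize l m ^ (x.1 + 1)} := fun v ↦
    ⟨(hf v).1, (hf v).2.2⟩
  { tree := parentGraph ⟨(0, 0), Nat.zero_le _, pow_pos (Nat.mul_pos hl (by omega)) _⟩
      fun t ↦ ⟨C.gapParent t, C.gapParent_mem hl t.2⟩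
    isTree := parentGraph_isTree (rank := fun t ↦ t.1.1 + t.1.2) hp
    bag t := f ⁻¹' C.gapBag t
    exists_mem_bag v := ⟨⟨f v, hgap v⟩, C.sep_subset_gapBag _ _ (hself v)⟩
    exists_bag_of_adj v w h := by
      rcases layeredGraph_adj.1 (f.map_adj_iff.2 h) with h | h | ⟨h1, h2 | h2⟩
      · exact ⟨⟨f v, hgap v⟩, C.sep_subset_gapBag _ _ (hself v),
          C.sep_subset_gapBag _ _ (hsep w _ _ (hf v).1 (Finset.mem_insert_of_mem h))⟩
      · exact ⟨⟨f w, hgap w⟩, C.sep_subset_gapBag _ _ (hsep v _ _ (hf w).1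
          (Finset.mem_insert_of_mem h)), C.sep_subset_gapBag _ _ (hself w)⟩
      · refine ⟨⟨f v, hgap v⟩, C.sep_subset_gapBag _ _ (hself v),
          C.sep_succ_subset_gapBag _ _ ?_⟩
        have := hself w
        rwa [← h1, ← h2] at this
      · refine ⟨⟨f w, hgap w⟩, C.sep_succ_subset_gapBag _ _ ?_,
          C.sep_subset_gapBag _ _ (hself w)⟩
        have := hself v
        rwa [h1, ← h2] at this
    connected v := by
      refine parentGraph_induce_connected (rank := fun t ↦ t.1.1 + t.1.2) hp _
        ⟨⟨f v, hgap v⟩, C.sep_subset_gapBag _ _ (hself v)⟩ fun s hs t ht hs' ht' ↦ ?_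
      have htop : ∀ t : Gap l m, f v ∈ C.gapBag t →
          (t ≠ ⟨(0, 0), Nat.zero_le _, pow_pos (Nat.mul_pos hl (by omega)) _⟩ →
            ¬ f v ∈ C.gapBag (C.gapParent t)) → C.top (f v).1 (f v).2 = (t.1.1, t.1.2 + 1) := by
        intro t ht ht'
        rcases C.mem_gapBag_gapParent_or_top_eq t.2.1 ht with h | h
        · exact absurd h.2 (ht' fun e ↦ h.1 (congrArg Subtype.val e))
        · exact h
      have h := (htop s hs hs').symm.trans (htop t ht ht')
      rw [Prod.mk.injEq] at h
      exact Subtype.ext (Prod.ext h.1 (Nat.succ_injective h.2)) }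

end ChildSystem

section

variable {l k m : ℕ} {V : Type*} [Finite V] {G : SimpleGraph V}

theorem exists_childSystem (hl : 0 < l) (f : G ↪g layeredGraph l k m)
    (hf : ∀ v, f v ∈ layerRegion l m) (hG : G.cliqueNum < k) :
    Nonempty (ChildSystem l k m (Set.range f)) := by
  have hpos : ∀ x ∈ Set.range f, x.2 ≠ 0 := by
    rintro _ ⟨v, rfl⟩
    exact (hf v).2.1.ne'
  have hex : ∀ i u, ∃ n', (u = 0 → n' = 0) ∧ (i < m → n' / boxSize l m = u ∧
      ∀ x ∈ upClosed l k m i u, x ∈ Set.range f → x ∈ upNbrs l k m (i + 1) n') := by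
    intro i u
    rcases Nat.eq_zero_or_pos u with rfl | hu
    · exact ⟨0, fun _ ↦ rfl, fun _ ↦ ⟨Nat.zero_div _, fun x hx hxf ↦
        absurd (snd_eq_zero_of_mem_upClosed hx) (hpos x hxf)⟩⟩
    by_cases hi : i < m
    · obtain ⟨n', h⟩ := exists_child (k := k) hl (by omega) hi.le u (Set.range f) (fun h ↦ by
        have := card_le_cliqueNum_of_embedding f (isClique_upClosed i u) h.2
        omega)
      exact ⟨n', fun h ↦ by omega, fun _ ↦ h⟩
    · exact ⟨0, fun _ ↦ rfl, fun h ↦ absurd h hi⟩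
  choose c hc0 hc using hex
  exact ⟨{ child := c
           child_div := fun i hi u ↦ (hc i u hi).1
           child_zero := fun i ↦ hc0 i 0 rfl
           mem_upNbrs_child := fun i hi u ↦ (hc i u hi).2
           snd_ne_zero := hpos }⟩

theorem ChildSystem.ncard_preimage_sep_le (f : G ↪g layeredGraph l k m)
    (C : ChildSystem l k m (Set.range f)) (i q : ℕ) :
    (f ⁻¹' C.sep i q).ncard ≤ G.cliqueNum := by
  rw [Set.ncard_eq_toFinset_card _ (Set.toFinite _)]
  refine SimpleGraph.IsClique.card_le_cliqueNum (tc := ?_)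
  intro v hv w hw hne
  rw [Set.Finite.coe_toFinset] at hv hw
  exact f.map_adj_iff.1 (isClique_upClosed _ _ hv.2 hw.2 (f.injective.ne hne))

theorem ChildSystem.ncard_preimage_gapBag_le (f : G ↪g layeredGraph l k m)
    (C : ChildSystem l k m (Set.range f)) (t : ℕ × ℕ) :
    (f ⁻¹' C.gapBag t).ncard ≤ 4 * G.cliqueNum := by
  have h := C.ncard_preimage_sep_le f
  obtain ⟨i, q⟩ := t
  cases i with
  | zero =>
    refine (Set.ncard_union_le (f ⁻¹' C.sep 0 q) (f ⁻¹' C.sep 0 (q + 1))).trans ?_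
    have := h 0 q
    have := h 0 (q + 1)
    omega
  | succ i =>
    refine (Set.ncard_union_le (f ⁻¹' (C.sep (i + 1) q ∪ C.sep (i + 1) (q + 1)))
      (f ⁻¹' (C.sep i (C.upper i q) ∪ C.sep i (C.upper i q + 1)))).trans ?_
    have h1 := Set.ncard_union_le (f ⁻¹' C.sep (i + 1) q) (f ⁻¹' C.sep (i + 1) (q + 1))
    have h2 := Set.ncard_union_le (f ⁻¹' C.sep i (C.upper i q))
      (f ⁻¹' C.sep i (C.upper i q + 1))
    rw [← Set.preimage_union] at h1 h2
    have := h (i + 1) q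
    have := h (i + 1) (q + 1)
    have := h i (C.upper i q)
    have := h i (C.upper i q + 1)
    omega

/-- The treewidth of an induced subgraph with clique number less than `k` is bounded linearly in
its clique number, independently of the number of layers and of `k`. -/
theorem treewidth_le_of_cliqueNum_lt (hl : 0 < l) (f : G ↪g layeredGraph l k m)
    (hf : ∀ v, f v ∈ layerRegion l m) (hG : G.cliqueNum < k) :
    treewidth G ≤ 4 * G.cliqueNum := by
  obtain ⟨C⟩ := exists_childSystem hl f hf hG
  have : Finite (ChildSystem.Gap l m) := finite_setOf_le_lt_boxSize_pow hl
  refine treewidth_le (ChildSystem.treeDecomposition hl f hf C) fun t ↦ ?_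
  have h : ((ChildSystem.treeDecomposition hl f hf C).bag t).ncard ≤ 4 * G.cliqueNum :=
    C.ncard_preimage_gapBag_le f t
  omega

end

/-! ### The class of graphs -/

/-- The graphs that embed in one of the finite layered graphs with parameters `l`, `k` and `m k`,
where `2 ≤ k`. -/
def layeredClass (l : ℕ) (m : ℕ → ℕ) : GraphClass.{u} := fun _ _ G ↦
  ∃ k, 2 ≤ k ∧ ∃ f : G ↪g layeredGraph l k (m k), ∀ v, f v ∈ layerRegion l (m k)

theorem layeredClass_twOmegaBounded {l : ℕ} (hl : 0 < l) (m : ℕ → ℕ) :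
    (layeredClass.{u} l m).TwOmegaBounded := by
  refine ⟨?_, fun j ↦ 4 * j + ∑ k ∈ Finset.range (j + 1), Nat.card (layerRegion l (m k)), ?_⟩
  · rintro V W _ _ G H ⟨k, hk, f, hf⟩ ⟨g⟩
    exact ⟨k, hk, f.comp g, fun v ↦ hf (g v)⟩
  · rintro V _ G ⟨k, hk, f, hf⟩
    rcases lt_or_ge G.cliqueNum k with h | h
    · refine (treewidth_le_of_cliqueNum_lt hl f hf h).trans ?_
      push_cast
      have : (0 : ℤ) ≤ ∑ k ∈ Finset.range (G.cliqueNum + 1),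
        (Nat.card (layerRegion l (m k)) : ℤ) := Finset.sum_nonneg fun _ _ ↦ Int.natCast_nonneg _
      omega
    · have : Finite (layerRegion l (m k)) := finite_layerRegion hl
      have h1 : Nat.card V ≤ Nat.card (layerRegion l (m k)) :=
        Nat.card_le_card_of_injective (fun v ↦ ⟨f v, hf v⟩) fun v w h ↦
          f.injective (congrArg Subtype.val h)
      have h2 : Nat.card (layerRegion l (m k)) ≤
          ∑ k ∈ Finset.range (G.cliqueNum + 1), Nat.card (layerRegion l (m k)) :=
        Finset.single_le_sum (f := fun k ↦ Nat.card (layerRegion l (m k)))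
          (fun _ _ ↦ Nat.zero_le _) (Finset.mem_range.2 (Nat.lt_succ_of_le h))
      refine (treewidth_le_card G).trans ?_
      exact_mod_cast h1.trans (h2.trans (Nat.le_add_left _ _))

theorem le_length_of_isHole_of_layeredClass {l : ℕ} {m : ℕ → ℕ} {V : Type u} [Finite V]
    {G : SimpleGraph V} (hG : layeredClass l m V G) {x : V} {w : G.Walk x x} (hw : IsHole w) :
    l ≤ w.length := by
  obtain ⟨k, -, f, -⟩ := hG
  exact le_length_of_isHole f hw

theorem exists_twOmegaBounded (g : ℕ+ → ℕ+) (l : ℕ) (hl : 4 ≤ l) :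
    ∃ C : GraphClass.{u}, C.TwOmegaBounded ∧
      (∀ (V : Type u) [Finite V] (G : SimpleGraph V), C V G →
        ∀ (x : V) (w : G.Walk x x), IsHole w → l ≤ w.length) ∧
      ∀ k : ℕ+, 2 ≤ k →
        ∃ (V : Type u) (_ : Finite V) (H : SimpleGraph V),
          C V H ∧ H.cliqueNum = (k : ℕ) ∧ ((g k : ℕ) : ℤ) ≤ treewidth H := by
  -- At least `k` layers are needed for a clique of size `k`.
  let m : ℕ → ℕ := fun k ↦ max k (if hk : 0 < k then g ⟨k, hk⟩ else 0)
  refine ⟨layeredClass l m, layeredClass_twOmegaBounded (by omega) m,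
    fun _ _ _ hG _ _ hw ↦ le_length_of_isHole_of_layeredClass hG hw, fun k hk ↦ ?_⟩
  have hk' : 2 ≤ (k : ℕ) := hk
  have hgm : (g k : ℕ) ≤ m k := by
    refine le_max_of_le_right ?_
    rw [dif_pos k.pos]
    rfl
  have : Finite (layerRegion l (m k)) := finite_layerRegion (by omega)
  refine ⟨_, inferInstance, finiteLayeredGraph l k (m k),
    ⟨k, hk', finiteLayeredGraphEmbedding l k (m k), fun v ↦ v.down.2⟩,
    cliqueNum_finiteLayeredGraph (by omega) hk' (le_max_left _ _), ?_⟩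
  exact (Int.ofNat_le.2 hgm).trans (le_treewidth_finiteLayeredGraph (by omega) hk')

theorem mainTheorem2 :
    (∀ (g : ℕ+ → ℕ+) (l : ℕ), 4 ≤ l →
      ∃ C : GraphClass.{u}, C.TwOmegaBounded ∧
        (∀ (V : Type u) [Finite V] (G : SimpleGraph V), C V G →
          ∀ (x : V) (w : G.Walk x x), IsHole w → l ≤ w.length) ∧
        ∀ k : ℕ+, 2 ≤ k →
          ∃ (V : Type u) (_ : Finite V) (H : SimpleGraph V),
            C V H ∧ H.cliqueNum = (k : ℕ) ∧ ((g k : ℕ) : ℤ) ≤ treewidth H) ∧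
    ¬ (∀ C : GraphClass.{u}, C.TwOmegaBounded → C.PolynomiallyBounded) := by
  refine ⟨exists_twOmegaBounded, fun h ↦ ?_⟩
  obtain ⟨C, hC, -, hg⟩ := exists_twOmegaBounded.{u} (fun k ↦ 3 ^ (k : ℕ)) 4 le_rfl
  obtain ⟨p, hp⟩ := h C hC
  -- `3 ^ k` dominates `exp k`, hence every polynomial in `k`.
  have hlim := (p.tendsto_div_exp_atTop.comp tendsto_natCast_atTop_atTop).eventually_lt_const
    one_pos
  obtain ⟨k, hk1, hk2⟩ := (hlim.and (Filter.eventually_ge_atTop 2)).exists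
  obtain ⟨V, _, H, hH, hω, htw⟩ := hg ⟨k, by omega⟩ hk2
  have h1 := hp V H hH
  rw [hω] at h1
  have h2 : ((3 ^ k : ℕ) : ℝ) ≤ (treewidth H : ℝ) := by
    have : ((3 ^ k : ℕ) : ℤ) ≤ treewidth H := by simpa using htw
    exact_mod_cast this
  have h3 : p.eval (k : ℝ) < Real.exp k := (div_lt_one (Real.exp_pos _)).1 hk1
  have h4 : Real.exp k ≤ 3 ^ k := by
    rw [← Real.exp_one_pow]
    exact pow_le_pow_left₀ (Real.exp_pos _).le Real.exp_one_lt_three.le k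
  push_cast at h2
  exact absurd (h2.trans h1) (not_le.2 (h3.trans_le h4))
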